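/- Let $(R,\mathfrak m)$ be a Noetherian local domain of Krull dimension $1$ which is $\mathfrak m$-adically complete, Gorenstein (i.e. of finite injective dimension as a module over itself) and not regular. Let $Q(R)$ be its field of fractions. Put $R_0=R$ and, inductively, $R_i=\operatorname{End}_{R_{i-1}}(\mathfrak m_{i-1})$ for $i\ge 1$, identified with the subring $\mathfrak m_{i-1}:\mathfrak m_{i-1}=\{x\in Q(R) : x\,\mathfrak m_{i-1}\subseteq\mathfrak m_{i-1}\}$ of $Q(R)$, where $\mathfrak m_{i-1}$ is the maximal ideal of $R_{i-1}$ (each $R_i$ is again a complete local domain). For a commutative Noetherian ring $A$, a finitely generated $A$-module $M$ is called Cohen--Macaulay if $\operatorname{depth} M_{\mathfrak p}\ge\operatorname{ht}\mathfrak p$ for all prime ideals $\mathfrak p$ of $A$ (the zero module having infinite depth), and $\mathsf{CM}(A)$ is the category of these modules. It is of finite type if there is a finitely generated $A$-module $G$ such that $\mathsf{CM}(A)=\operatorname{add}(G)$, the class of modules isomorphic to direct summands of finite direct sums of copies of $G$. Let $\underline{\mathsf{CM}}(R)$ be the stable category of $\mathsf{CM}(R)$: its objects are those of $\mathsf{CM}(R)$,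 and its morphisms are the homomorphisms modulo those that factor through a finitely generated projective module. It is a triangulated category, in which $X[1]\cong Y$ for every exact sequence $0\to X\to P\to Y\to 0$ in $\mathsf{CM}(R)$ with $P$ projective, and whose distinguished triangles are, up to isomorphism, those induced by the short exact sequences in $\mathsf{CM}(R)$. For a class $\mathcal X$ of objects let $\langle\mathcal X\rangle$ be the smallest full subcategory containing $\mathcal X$ and closed under finite direct sums, direct summands and shifts; put $\langle G\rangle_0=0$, and let $\langle G\rangle_{k+1}=\langle\mathcal E_k\rangle$, where $\mathcal E_k$ is the class of the objects $M$ for which there is a distinguished triangle $X\to M\to Y\to X[1]$ with $X\in\langle G\rangle_k$ and $Y\in\langle G\rangle$. The dimension $\dim\underline{\mathsf{CM}}(R)$ (in the sense of Rouquier) is the least integer $d\ge 0$ such that $\underline{\mathsf{CM}}(R)=\langle G\rangle_{d+1}$ for some object $G$, or $\infty$ if there is no such $d$. Let $n\ge 1$ be an integer. If $\mathsf{CM}(R_n)$ is of finite type, then $\dim\underline{\mathsf{CM}}(R)\le n-1$. -/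

import Mathlib

open CategoryTheory CategoryTheory.Limits IsLocalRing

universe u

noncomputable section

namespace CMStable

/-! ### Cohen–Macaulay modules, finite type, Gorenstein local rings -/

/-- The depth of a finitely generated module `M` over a Noetherian local ring `A`: the supremum of
the lengths of the `M`-regular sequences in the maximal ideal. For `M ≠ 0` weakly regular sequences
in the maximal ideal are regular by Nakayama; the zero module gets depth `∞`, as usual. -/
def depth (A : Type u) [CommRing A] [IsLocalRing A] (M : Type u) [AddCommGroup M] [Module A M] :
    ℕ∞ :=
  ⨆ (rs : List A) (_ : (∀ r ∈ rs, r ∈ maximalIdeal A) ∧ RingTheory.Sequence.IsWeaklyRegular M rs),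
    (rs.length : ℕ∞)

/-- A finitely generated `A`-module `M` is (maximal) Cohen–Macaulay if
`depth M_𝔭 ≥ height 𝔭` for every prime ideal `𝔭` of `A`. -/
def isCM (A : Type u) [CommRing A] : ObjectProperty (ModuleCat.{u} A) := fun M =>
  Module.Finite A M ∧
    ∀ (p : Ideal A) [p.IsPrime],
      p.height ≤ depth (Localization.AtPrime p) (LocalizedModule p.primeCompl M)

/-- `M` belongs to `add G`: it is a direct summand of a finite direct sum of copies of `G`. -/
def InAdd {A : Type u} [CommRing A] (G M : ModuleCat.{u} A) : Prop :=
  ∃ (k : ℕ) (N : ModuleCat.{u} A), Nonempty ((M × N) ≃ₗ[A] (Fin k → G))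

/-- `CM(A)` is of finite type: `CM(A) = add G` for some finitely generated `A`-module `G`. -/
def CMFiniteType (A : Type u) [CommRing A] : Prop :=
  ∃ G : ModuleCat.{u} A, Module.Finite A G ∧ ∀ M : ModuleCat.{u} A, isCM A M ↔ InAdd G M

/-- A Noetherian local ring is Gorenstein if it has finite injective dimension as a module over
itself. -/
class IsGorensteinLocalRing (R : Type u) [CommRing R] : Prop
    extends IsLocalRing R, IsNoetherianRing R where
  finite_injectiveDimension : ∃ d : ℕ, HasInjectiveDimensionLE (ModuleCat.of R R) d

/-! ### The iterated endomorphism rings of the maximal ideal -/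

section Endo

variable {R : Type u} [CommRing R] [IsDomain R]

/-- For a local ring `S` with `R ⊆ S ⊆ Q(R)` and maximal ideal `𝔫`, the ring
`𝔫 : 𝔫 = {x ∈ Q(R) | x 𝔫 ⊆ 𝔫}`, which is `End_S(𝔫)` by `endMaxEquiv` below. The maximal ideal is
written as the Jacobson radical, so that locality of `S` is not needed for the definition. -/
def endMax (S : Subalgebra R (FractionRing R)) : Subalgebra R (FractionRing R) where
  carrier := {x | ∀ y ∈ Ring.jacobson S, ∃ z ∈ Ring.jacobson S,
    (z : FractionRing R) = x * (y : FractionRing R)}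
  mul_mem' := by
    intro a b ha hb y hy
    obtain ⟨z, hz, hz'⟩ := hb y hy
    obtain ⟨w, hw, hw'⟩ := ha z hz
    exact ⟨w, hw, by rw [hw', hz', mul_assoc]⟩
  add_mem' := by
    intro a b ha hb y hy
    obtain ⟨z, hz, hz'⟩ := ha y hy
    obtain ⟨w, hw, hw'⟩ := hb y hy
    exact ⟨z + w, add_mem hz hw, by simp [hw', hz', add_mul]⟩
  algebraMap_mem' := by
    intro r y hy
    refine ⟨algebraMap R S r * y, Ideal.mul_mem_left _ _ hy, ?_⟩
    simp

set_option synthInstance.maxHeartbeats 200000 in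
set_option maxHeartbeats 1000000 in
/-- Multiplication by elements of `𝔫 : 𝔫` identifies `𝔫 : 𝔫` with `End_S(𝔫)`, for a local ring `S`
(not a field) between `R` and `Q(R)`. -/
theorem endMaxEquiv (S : Subalgebra R (FractionRing R)) [IsLocalRing S]
    (hS : maximalIdeal S ≠ ⊥) :
    ∃ e : endMax S ≃+* Module.End S (maximalIdeal S),
      ∀ (x : endMax S) (y : maximalIdeal S),
        ((e x y : S) : FractionRing R) = (x : FractionRing R) * ((y : S) : FractionRing R) := by
  have hJ : Ring.jacobson S = maximalIdeal S := IsLocalRing.ringJacobson_eq_maximalIdeal S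
  have hmem : ∀ (x : endMax S) (y : maximalIdeal S), ∃ z : maximalIdeal S,
      ((z : S) : FractionRing R) = (x : FractionRing R) * ((y : S) : FractionRing R) := by
    intro x y
    obtain ⟨z, hz, h⟩ := x.2 y.1 (hJ.ge y.2)
    exact ⟨⟨z, hJ.le hz⟩, h⟩
  choose m hm using hmem
  have hinj : ∀ z w : maximalIdeal S,
      ((z : S) : FractionRing R) = ((w : S) : FractionRing R) → z = w :=
    fun z w h => Subtype.ext (Subtype.ext h)
  let φ : endMax S →+* Module.End S (maximalIdeal S) :=
    { toFun := fun x =>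
        { toFun := m x
          map_add' := fun y z => hinj _ _ (by simp [hm, mul_add])
          map_smul' := fun s y => hinj _ _ (by simp [hm, mul_left_comm]) }
      map_one' := LinearMap.ext fun y => hinj _ _ (by simp [hm])
      map_mul' := fun a b => LinearMap.ext fun y => hinj _ _ (by simp [hm, mul_assoc])
      map_zero' := LinearMap.ext fun y => hinj _ _ (by simp [hm])
      map_add' := fun a b => LinearMap.ext fun y => hinj _ _ (by simp [hm, add_mul]) }
  have hφ : ∀ x y, φ x y = m x y := fun _ _ => rfl
  obtain ⟨y, hy, hy0⟩ := Submodule.exists_mem_ne_zero_of_ne_bot hS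
  have hyK : (y : FractionRing R) ≠ 0 := fun h => hy0 (Subtype.ext h)
  refine ⟨RingEquiv.ofBijective φ ⟨?_, ?_⟩, fun x z => hm x z⟩
  · intro a b hab
    have h := congrArg (fun t : maximalIdeal S => ((t : S) : FractionRing R))
      (LinearMap.congr_fun hab ⟨y, hy⟩)
    simp only [hφ, hm] at h
    exact Subtype.ext (mul_right_cancel₀ hyK h)
  · intro f
    have key : ∀ z : maximalIdeal S, ((f z : S) : FractionRing R) =
        ((f ⟨y, hy⟩ : S) : FractionRing R) / (y : FractionRing R) * ((z : S) : FractionRing R) := by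
      intro z
      have h₁ : y • f z = (z : S) • f ⟨y, hy⟩ := by
        rw [← map_smul, ← map_smul]
        congr 1
        exact Subtype.ext (mul_comm _ _)
      have h₂ := congrArg (fun t : maximalIdeal S => ((t : S) : FractionRing R)) h₁
      simp only [Submodule.coe_smul, smul_eq_mul, MulMemClass.coe_mul] at h₂
      field_simp
      rw [mul_comm, h₂, mul_comm]
    refine ⟨⟨((f ⟨y, hy⟩ : S) : FractionRing R) / (y : FractionRing R), ?_⟩, ?_⟩
    · intro z hz
      exact ⟨f ⟨z, hJ.le hz⟩, hJ.ge (f ⟨z, hJ.le hz⟩).2, key ⟨z, hJ.le hz⟩⟩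
    · exact LinearMap.ext fun z => hinj _ _ (by rw [hφ, hm, key z])

/-- The ring `R_n`: `R_0 = R` and `R_{n+1} = End_{R_n}(𝔪_n)`, realised inside `Q(R)`. -/
def iterEnd (R : Type u) [CommRing R] [IsDomain R] : ℕ → Subalgebra R (FractionRing R)
  | 0 => ⊥
  | n + 1 => endMax (iterEnd R n)

end Endo

/-! ### The stable category of `CM(R)` -/

section Stable

variable (R : Type u) [CommRing R]

/-- The category `CM(R)`, a full subcategory of the category of `R`-modules. -/
abbrev CMCat := (isCM R).FullSubcategory

/-- Two maps of Cohen–Macaulay modules are stably equal if their difference factors through a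
finitely generated projective module. -/
def stableRel : HomRel (CMCat R) := fun X Y f g =>
  ∃ (P : ModuleCat.{u} R) (a : X.obj ⟶ P) (b : P ⟶ Y.obj),
    Module.Finite R P ∧ Module.Projective R P ∧ f.hom - g.hom = a ≫ b

variable {R} in
lemma stableRel_add {X Y : CMCat R} {f₁ f₂ g₁ g₂ : X ⟶ Y}
    (hf : stableRel R f₁ f₂) (hg : stableRel R g₁ g₂) : stableRel R (f₁ + g₁) (f₂ + g₂) := by
  obtain ⟨P, a, b, _, _, h⟩ := hf
  obtain ⟨Q, c, d, _, _, h'⟩ := hg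
  refine ⟨ModuleCat.of R (P × Q), ModuleCat.ofHom (a.hom.prod c.hom),
    ModuleCat.ofHom (b.hom.coprod d.hom), inferInstanceAs (Module.Finite R (P × Q)),
    inferInstanceAs (Module.Projective R (P × Q)), ?_⟩
  have : (f₁ + g₁).hom - (f₂ + g₂).hom = (f₁.hom - f₂.hom) + (g₁.hom - g₂.hom) := by
    change (f₁.hom + g₁.hom) - (f₂.hom + g₂.hom) = _
    abel
  rw [this, h, h']
  ext x
  simp

instance : Congruence (stableRel R) where
  equivalence :=
    { refl := fun f => ⟨ModuleCat.of R PUnit, 0, 0, inferInstanceAs (Module.Finite R PUnit.{u + 1}),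
        inferInstanceAs (Module.Projective R PUnit.{u + 1}), by simp⟩
      symm := by
        rintro f g ⟨P, a, b, h₁, h₂, h⟩
        exact ⟨P, -a, b, h₁, h₂, by rw [Preadditive.neg_comp, ← h, neg_sub]⟩
      trans := by
        intro f g k h₁ h₂
        have h := stableRel_add h₁ h₂
        obtain ⟨P, a, b, h₁, h₂, h⟩ := h
        refine ⟨P, a, b, h₁, h₂, ?_⟩
        rw [← h]
        change _ = (f.hom + g.hom) - (g.hom + k.hom)
        abel }
  comp_left := by
    rintro X Y Z f g g' ⟨P, a, b, h₁, h₂, h⟩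
    exact ⟨P, f.hom ≫ a, b, h₁, h₂, by
      rw [Category.assoc, ← h, Preadditive.comp_sub]; rfl⟩
  comp_right := by
    rintro X Y Z f f' g ⟨P, a, b, h₁, h₂, h⟩
    exact ⟨P, a, b ≫ g.hom, h₁, h₂, by
      rw [← Category.assoc, ← h, Preadditive.sub_comp]; rfl⟩

/-- The stable category of `CM(R)`: the objects are those of `CM(R)`, and morphisms are taken
modulo those that factor through a finitely generated projective module. -/
abbrev StableCM := CategoryTheory.Quotient (stableRel R)

instance : Preadditive (StableCM R) :=
  CategoryTheory.Quotient.preadditive _ (fun _ _ _ _ _ _ hf hg => stableRel_add hf hg)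

/-- The projection functor `CM(R) ⥤ StableCM R`. -/
abbrev proj : CMCat R ⥤ StableCM R := CategoryTheory.Quotient.functor (stableRel R)

variable {R}

/-- The exact structure of `CM(R)`: short exact sequences of modules with all terms in `CM(R)`. -/
def IsConflation (S : ShortComplex (CMCat R)) : Prop :=
  (S.map (isCM R).ι).ShortExact

/-- `Y` is a model of the shift `X[1]` in the stable category: up to isomorphism in the stable
category there is a short exact sequence `0 ⟶ X ⟶ P ⟶ Y ⟶ 0` in `CM(R)` with `P` projective.
For Gorenstein `R` the finitely generated projective modules are the projective-injective objects
of the Frobenius category `CM(R)`, and this determines `X[1]` and `Y[-1]` up to isomorphism. -/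
def IsShift (X Y : StableCM R) : Prop :=
  ∃ S : ShortComplex (CMCat R), IsConflation S ∧ Module.Projective R S.X₂.obj ∧
    Nonempty (X ≅ (proj R).obj S.X₁) ∧ Nonempty (Y ≅ (proj R).obj S.X₃)

/-- `X ⟶ Y ⟶ Z` are the first two maps of a distinguished triangle `X ⟶ Y ⟶ Z ⟶ X[1]` of the
stable category: up to isomorphism these are the images of the short exact sequences
in `CM(R)`. -/
def IsTriangle {X Y Z : StableCM R} (f : X ⟶ Y) (g : Y ⟶ Z) : Prop :=
  ∃ (S : ShortComplex (CMCat R)) (a : X ≅ (proj R).obj S.X₁) (b : Y ≅ (proj R).obj S.X₂)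
    (c : Z ≅ (proj R).obj S.X₃), IsConflation S ∧
      f ≫ b.hom = a.hom ≫ (proj R).map S.f ∧ g ≫ c.hom = b.hom ≫ (proj R).map S.g

/-! ### Rouquier's dimension -/

/-- `⟨𝒳⟩`: the smallest full subcategory of the stable category that contains `𝒳` and is closed
under finite direct sums, direct summands (in particular isomorphisms) and shifts. -/
inductive Gen (𝒳 : ObjectProperty (StableCM R)) : ObjectProperty (StableCM R)
  | of (X : StableCM R) (h : 𝒳 X) : Gen 𝒳 X
  | zero (X : StableCM R) (h : IsZero X) : Gen 𝒳 X
  | sum (X Y : StableCM R) (b : BinaryBicone X Y) (hb : b.IsBilimit) (hX : Gen 𝒳 X)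
      (hY : Gen 𝒳 Y) : Gen 𝒳 b.pt
  | summand (X Y : StableCM R) (b : BinaryBicone X Y) (hb : b.IsBilimit) (h : Gen 𝒳 b.pt) :
      Gen 𝒳 X
  | shift (X Y : StableCM R) (s : IsShift X Y) (h : Gen 𝒳 X) : Gen 𝒳 Y
  | unshift (X Y : StableCM R) (s : IsShift X Y) (h : Gen 𝒳 Y) : Gen 𝒳 X

/-- `𝒳 * 𝒴`: the objects `M` in a distinguished triangle `X ⟶ M ⟶ Y ⟶ X[1]` with `X ∈ 𝒳` and
`Y ∈ 𝒴`. -/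
def star (𝒳 𝒴 : ObjectProperty (StableCM R)) : ObjectProperty (StableCM R) := fun M =>
  ∃ (X Y : StableCM R) (f : X ⟶ M) (g : M ⟶ Y), 𝒳 X ∧ 𝒴 Y ∧ IsTriangle f g

/-- `⟨G⟩_0 = 0` and `⟨G⟩_{k+1} = ⟨⟨G⟩_k * ⟨G⟩⟩`. -/
def level (G : StableCM R) : ℕ → ObjectProperty (StableCM R)
  | 0 => fun X => IsZero X
  | k + 1 => Gen (star (level G k) (Gen (fun X => X = G)))

variable (R) in
/-- The dimension of the stable category of `CM(R)`: the least `d ≥ 0` such that the whole category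
is `⟨G⟩_{d+1}` for some object `G`, and `∞` if there is none. -/
def stableDim : ℕ∞ :=
  ⨅ (d : ℕ) (_ : ∃ G : StableCM R, ∀ X : StableCM R, level G (d + 1) X), (d : ℕ∞)

end Stable

end CMStable

end

/-! Put `K` for the fraction field and `𝔪`, `k` for the maximal ideal and residue field of `R`. Over
a one-dimensional domain that is not a field, Cohen–Macaulay means finitely generated and
torsion-free. Since `R` is Gorenstein, such `M` satisfy `Ext^1(M, R) = 0` (`extVanish_one`) and are
reflexive (`dual_eval_surjective`).

If `M` has no free summand, every functional on `M` has values in `𝔪`. For `r ∈ R_1 = 𝔪 : 𝔪` and `v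
∈ M` the map `f ↦ r f(v)` is then a functional on the dual of `M`, so by reflexivity it is
evaluation at an element of `M`, namely `r v`. Hence `M`, embedded in some `K^d`, is an `R_1`-module
(`isStable_iterEnd_one`).

If `M` is an `R_l`-module and `J` is the Jacobson radical of `R_l`, then `J M` is stable under
`R_{l+1} = J : J`, and `M / J M` is killed by `𝔪`, so it is `k^s`. Fix an extension `0 → R → L → k →
0` with `L` an ideal. The pullback `E` of `M → k^s ← L^s` is an extension of `M` by `R^s`, which
splits, so `E` is stably `M`; it is also an extension of `L^s` by `J M`. Thus `M` is one triangle
away from `J M` (`level_succ_of_maximalIdeal_smul_mem`). After `n - 1` such steps from `R_1` one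
reaches `R_n`-modules, which lie in `add G`. So `G ⊕ L` generates everything in `n` levels. -/

noncomputable section

namespace CMStable

/-! ### Vanishing of Ext into a Gorenstein ring, and reflexivity -/

section Ext

open Abelian Module

variable {R : Type u} [CommRing R]

/-- The short exact sequence attached to an exact pair of linear maps. -/
lemma shortExact_ofHom {M N P : Type u} [AddCommGroup M] [AddCommGroup N] [AddCommGroup P]
    [Module R M] [Module R N] [Module R P] (f : M →ₗ[R] N) (g : N →ₗ[R] P)
    (hf : Function.Injective f) (hg : Function.Surjective g) (h : Function.Exact f g) :
    (ShortComplex.mk (ModuleCat.ofHom f) (ModuleCat.ofHom g)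
      (by ext x; exact h.apply_apply_eq_zero x)).ShortExact where
  exact := (ShortComplex.ShortExact.moduleCat_exact_iff_function_exact _).2 h
  mono_f := (ModuleCat.mono_iff_injective _).2 hf
  epi_g := (ModuleCat.epi_iff_surjective _).2 hg

/-- The vanishing of `Ext^j(M, R)`. -/
def ExtVanish (R : Type u) [CommRing R] (j : ℕ) (M : Type u) [AddCommGroup M] [Module R M] : Prop :=
  Subsingleton (Ext (ModuleCat.of R M) (ModuleCat.of R R) j)

variable {M N P : Type u} [AddCommGroup M] [AddCommGroup N] [AddCommGroup P]
    [Module R M] [Module R N] [Module R P]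

lemma ExtVanish.of_projective [Module.Projective R M] {j : ℕ} (hj : j ≠ 0) :
    ExtVanish R j M := by
  obtain ⟨j, rfl⟩ := Nat.exists_eq_succ_of_ne_zero hj
  exact subsingleton_of_forall_eq 0 Ext.eq_zero_of_projective

lemma ExtVanish.middle {f : M →ₗ[R] N} {g : N →ₗ[R] P}
    (hf : Function.Injective f) (hg : Function.Surjective g) (h : Function.Exact f g) {j : ℕ}
    (h₁ : ExtVanish R j M) (h₃ : ExtVanish R j P) : ExtVanish R j N := by
  refine subsingleton_of_forall_eq 0 fun x => ?_
  obtain ⟨y, rfl⟩ := Ext.contravariant_sequence_exact₂ (shortExact_ofHom f g hf hg h) _ x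
    (h₁.elim _ _)
  rw [h₃.elim y 0, Ext.comp_zero]

lemma ExtVanish.right {f : M →ₗ[R] N} {g : N →ₗ[R] P}
    (hf : Function.Injective f) (hg : Function.Surjective g) (h : Function.Exact f g) {j : ℕ}
    (h₁ : ExtVanish R j M) (h₂ : ExtVanish R (j + 1) N) : ExtVanish R (j + 1) P := by
  refine subsingleton_of_forall_eq 0 fun x => ?_
  obtain ⟨y, rfl⟩ := Ext.contravariant_sequence_exact₃ (shortExact_ofHom f g hf hg h) _ x
    (h₂.elim _ _) (add_comm 1 j)
  rw [h₁.elim y 0, Ext.comp_zero]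

lemma ExtVanish.left {f : M →ₗ[R] N} {g : N →ₗ[R] P}
    (hf : Function.Injective f) (hg : Function.Surjective g) (h : Function.Exact f g) {j : ℕ}
    (h₂ : ExtVanish R j N) (h₃ : ExtVanish R (j + 1) P) : ExtVanish R j M := by
  refine subsingleton_of_forall_eq 0 fun x => ?_
  obtain ⟨y, rfl⟩ := Ext.contravariant_sequence_exact₁ (shortExact_ofHom f g hf hg h) _ x
    (add_comm 1 j) (h₃.elim _ _)
  rw [h₂.elim y 0, Ext.comp_zero]

/-- The degree-zero end of the long exact sequence; this is the form in which `Ext^1` vanishing is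
used for duals and splittings. -/
lemma ExtVanish.exists_extend {f : M →ₗ[R] N} {g : N →ₗ[R] P}
    (hf : Function.Injective f) (hg : Function.Surjective g) (h : Function.Exact f g)
    (h₃ : ExtVanish R 1 P) (a : M →ₗ[R] R) : ∃ b : N →ₗ[R] R, b ∘ₗ f = a := by
  obtain ⟨y, hy⟩ := Ext.contravariant_sequence_exact₁ (shortExact_ofHom f g hf hg h) _
    (Ext.mk₀ (ModuleCat.ofHom a)) (add_zero 1) (h₃.elim _ _)
  obtain ⟨y, rfl⟩ := Ext.homEquiv₀.symm.surjective y
  refine ⟨y.hom, ?_⟩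
  rw [Ext.homEquiv₀_symm_apply, Ext.mk₀_comp_mk₀] at hy
  have := Ext.homEquiv₀.symm.injective hy
  exact congrArg ModuleCat.Hom.hom this

lemma ExtVanish.of_linearEquiv (e : M ≃ₗ[R] N) {j : ℕ} (h : ExtVanish R j N) :
    ExtVanish R j M := by
  refine ExtVanish.middle (M := PUnit.{u+1}) (f := 0) (g := e.toLinearMap)
    (Function.injective_of_subsingleton _) e.surjective ?_ ?_ h
  · intro x
    simpa using eq_comm
  · exact subsingleton_of_forall_eq 0 fun x => by
      rw [← x.mk₀_id_comp, (ModuleCat.isZero_of_subsingleton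
        (ModuleCat.of R PUnit)).eq_zero_of_src (𝟙 _), Ext.mk₀_zero, Ext.zero_comp]

/-- In a one-dimensional Noetherian local domain the maximal ideal is of the form `(x : y)`. -/
lemma exists_colon_eq_maximalIdeal [IsLocalRing R] [IsNoetherianRing R] [Ring.DimensionLEOne R]
    (hR : ¬ IsField R) : ∃ x y : R, x ≠ 0 ∧ x ∈ maximalIdeal R ∧
      ∀ r, r ∈ maximalIdeal R ↔ x ∣ r * y := by
  obtain ⟨x, hx, hx0⟩ := Submodule.exists_mem_ne_zero_of_ne_bot
    (mt IsLocalRing.isField_iff_maximalIdeal_eq.2 hR)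
  have : Nontrivial (R ⧸ Ideal.span {x}) := Ideal.Quotient.nontrivial_iff.2 (by
    rw [Ne, Ideal.span_singleton_eq_top]
    exact hx)
  -- An associated prime of `R / x` is the annihilator of the class of some `y`. It contains `x ≠
  -- 0`, so dimension one makes it maximal.
  obtain ⟨p, hp⟩ := associatedPrimes.nonempty R (R ⧸ Ideal.span {x})
  obtain ⟨hp, y, hy⟩ := isAssociatedPrime_iff.1 hp
  obtain ⟨y, rfl⟩ := Ideal.Quotient.mk_surjective y
  have key : ∀ r, r ∈ p ↔ x ∣ r * y := by
    intro r
    rw [hy, Submodule.mem_colon_singleton, Submodule.mem_bot, Algebra.smul_def,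
      Ideal.Quotient.algebraMap_eq, ← map_mul, Ideal.Quotient.eq_zero_iff_mem,
      Ideal.mem_span_singleton]
  have hpm : p = maximalIdeal R := IsLocalRing.eq_maximalIdeal <| hp.isMaximal fun h => hx0 <| by
    rw [← Ideal.mem_bot, ← h, key]
    exact dvd_mul_right x y
  exact ⟨x, y, hx0, hx, hpm ▸ key⟩

variable [IsDomain R]

/-- A finitely generated torsion-free module over a domain embeds in a finitely generated free
module. -/
lemma exists_injective_fin_pi [Module.Finite R M] [IsTorsionFree R M] :
    ∃ (n : ℕ) (f : M →ₗ[R] (Fin n → R)), Function.Injective f := by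
  classical
  obtain ⟨k, s, hs⟩ := Module.Finite.exists_fin (R := R) (M := M)
  -- A maximal independent subfamily of the generators spans a free module `N`. Each generator has a
  -- nonzero multiple in `N`, so the product of these scalars maps all of `M` into `N`, injectively
  -- by torsion-freeness.
  obtain ⟨I, hI, hmax⟩ := exists_maximal_linearIndepOn R s
  let N := Submodule.span R (Set.range fun i : I => s i)
  have hN : Submodule.span R (s '' I) = N := by rw [Set.image_eq_range]
  let b : Basis I R N := Basis.span hI
  have exists_a : ∀ i, ∃ a : R, a ≠ 0 ∧ a • s i ∈ N := by
    intro i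
    by_cases hi : i ∈ I
    · exact ⟨1, one_ne_zero, by
        rw [one_smul]; exact Submodule.subset_span (Set.mem_range_self (⟨i, hi⟩ : I))⟩
    · exact hN ▸ hmax i hi
  choose a ha ha' using exists_a
  have hA : ∏ i, a i ≠ 0 := Finset.prod_ne_zero_iff.2 fun i _ => ha i
  have hle : ∀ x, LinearMap.lsmul R M (∏ i, a i) x ∈ N := by
    suffices LinearMap.range (LinearMap.lsmul R M (∏ i, a i)) ≤ N from
      fun x => this (LinearMap.mem_range_self _ x)
    rw [LinearMap.range_eq_map, ← hs, Submodule.map_span_le]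
    rintro _ ⟨i, rfl⟩
    rw [LinearMap.lsmul_apply, Fintype.prod_eq_prod_compl_mul i, mul_smul]
    exact N.smul_mem _ (ha' i)
  let e := b.equivFun.trans (LinearEquiv.funCongrLeft R R (Fintype.equivFin I).symm)
  refine ⟨_, e.toLinearMap ∘ₗ (LinearMap.lsmul R M (∏ i, a i)).codRestrict N hle,
    e.injective.comp fun x y hxy => ?_⟩
  exact smul_right_injective M hA (congrArg Subtype.val hxy)

/-- The coordinates of an embedding into a free module already separate points. -/
lemma dual_eval_injective [Module.Finite R M] [IsTorsionFree R M] :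
    Function.Injective (Dual.eval R M) := by
  obtain ⟨n, f, hf⟩ := exists_injective_fin_pi (R := R) (M := M)
  refine (injective_iff_map_eq_zero _).2 fun x hx => hf ?_
  ext i
  simpa using LinearMap.congr_fun hx (LinearMap.proj i ∘ₗ f)

/-- Vanishing descends by one degree: `k` embeds in `R / x`, whose projective dimension is at most
one, so `Ext^j(k, R)` is squeezed between `Ext^j(R / x, R) = 0` and a vanishing `Ext^{j+1}`. A prime
filtration, with only the primes `0` and `𝔪`, then reaches all finitely generated modules. -/
lemma extVanish_of_succ [IsLocalRing R] [IsNoetherianRing R] [Ring.DimensionLEOne R]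
    (hR : ¬ IsField R) {j : ℕ} (hj : 2 ≤ j)
    (h : ∀ (M : Type u) [AddCommGroup M] [Module R M] [Module.Finite R M], ExtVanish R (j + 1) M)
    (M : Type u) [AddCommGroup M] [Module R M] [hM : Module.Finite R M] : ExtVanish R j M := by
  obtain ⟨x, y, hx0, hx, hxy⟩ := exists_colon_eq_maximalIdeal hR
  obtain ⟨i, rfl⟩ : ∃ i, j = i + 1 := ⟨j - 1, by omega⟩
  have hquot : ExtVanish R (i + 1) (R ⧸ Ideal.span {x}) := by
    refine ExtVanish.right (f := LinearMap.lsmul R R x) (g := (Ideal.span {x}).mkQ)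
      (smul_right_injective R hx0) (Submodule.mkQ_surjective _) ?_
      (ExtVanish.of_projective (by omega)) (ExtVanish.of_projective (by omega))
    intro r
    rw [Submodule.mkQ_apply, Submodule.Quotient.mk_eq_zero, Ideal.mem_span_singleton]
    exact ⟨fun ⟨c, hc⟩ => ⟨c, hc.symm⟩, fun ⟨c, hc⟩ => ⟨c, hc.symm⟩⟩
  -- Multiplication by `y` embeds the residue field in `R / x`, because `𝔪 = (x : y)`.
  have hk : ExtVanish R (i + 1) (R ⧸ maximalIdeal R) := by
    let f : (R ⧸ maximalIdeal R) →ₗ[R] (R ⧸ Ideal.span {x}) :=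
      (maximalIdeal R).liftQ ((Ideal.span {x}).mkQ ∘ₗ LinearMap.lsmul R R y) fun r hr => by
        rw [LinearMap.mem_ker, LinearMap.comp_apply, Submodule.mkQ_apply,
          Submodule.Quotient.mk_eq_zero, Ideal.mem_span_singleton, LinearMap.lsmul_apply,
          smul_eq_mul, mul_comm]
        exact (hxy r).1 hr
    have hf : Function.Injective f := by
      rw [← LinearMap.ker_eq_bot]
      refine Submodule.ker_liftQ_eq_bot _ _ _ fun r hr => ?_
      rw [LinearMap.mem_ker, LinearMap.comp_apply, Submodule.mkQ_apply,
        Submodule.Quotient.mk_eq_zero, Ideal.mem_span_singleton, LinearMap.lsmul_apply,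
        smul_eq_mul, mul_comm] at hr
      exact (hxy r).2 hr
    exact ExtVanish.left hf (Submodule.mkQ_surjective (LinearMap.range f))
      (LinearMap.exact_map_mkQ_range f) hquot (h _)
  induction hM using IsNoetherianRing.induction_on_isQuotientEquivQuotientPrime R with
  | subsingleton N => exact ExtVanish.of_projective (by omega)
  | quotient N p e =>
    by_cases hp : p.1 = ⊥
    · exact (ExtVanish.of_projective (M := R) (by omega)).of_linearEquiv
        (e.trans (Submodule.quotEquivOfEqBot _ hp))
    · have := IsLocalRing.eq_maximalIdeal (p.2.isMaximal hp)
      exact hk.of_linearEquiv (e.trans (Submodule.quotEquivOfEq _ _ this))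
  | exact N₁ N₂ N₃ f g hf hg hfg h₁ h₃ => exact ExtVanish.middle hf hg hfg h₁ h₃

variable [IsGorensteinLocalRing R] [Ring.DimensionLEOne R]

/-- Over a one-dimensional Gorenstein local domain `Ext^1(M, R)` vanishes for all finitely
generated torsion-free modules `M`. -/
theorem extVanish_one (hR : ¬ IsField R) [Module.Finite R M] [IsTorsionFree R M] :
    ExtVanish R 1 M := by
  obtain ⟨d, hd⟩ := IsGorensteinLocalRing.finite_injectiveDimension (R := R)
  -- Descent from degrees above the injective dimension `d` to degree 2; `k` bounds the number of
  -- descents needed.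
  have key : ∀ k j : ℕ, 2 ≤ j → d + 1 ≤ j + k →
      ∀ (M : Type u) [AddCommGroup M] [Module R M] [Module.Finite R M], ExtVanish R j M := by
    intro k
    induction k with
    | zero => exact fun j _ hj M _ _ _ => hd.subsingleton _ _ _ (by simpa using hj) _
    | succ k ih => exact fun j hj hk => extVanish_of_succ hR hj (ih (j + 1) (by omega) (by omega))
  -- Dimension shift: `Ext^1(M, R)` is controlled by `Ext^2` of the cokernel of an embedding into a
  -- free module.
  obtain ⟨n, f, hf⟩ := exists_injective_fin_pi (R := R) (M := M)
  exact ExtVanish.left hf (Submodule.mkQ_surjective (LinearMap.range f))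
    (LinearMap.exact_map_mkQ_range f) (ExtVanish.of_projective one_ne_zero)
    (key d 2 le_rfl (by omega) _)

/-- Finitely generated torsion-free modules over a one-dimensional Gorenstein local domain are
reflexive. -/
theorem dual_eval_surjective (hR : ¬ IsField R) [Module.Finite R M] [IsTorsionFree R M] :
    Function.Surjective (Dual.eval R M) := by
  -- Dualising `0 → ker p → R^n → M → 0` stays exact as `Ext^1(M, R) = 0`. As `Ext^1` of the dual of
  -- `ker p` vanishes too, a functional on the dual of `M` extends to the dual of `R^n`, where it is
  -- evaluation at some `w`.
  obtain ⟨n, p, hp⟩ := Module.Finite.exists_fin' R M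
  have hpK : Function.Exact (LinearMap.ker p).subtype p := LinearMap.exact_subtype_ker_map p
  have hsurj : Function.Surjective (LinearMap.ker p).subtype.dualMap := fun a =>
    ExtVanish.exists_extend (Submodule.injective_subtype _) hp hpK (extVanish_one hR) a
  have : Module.Finite R (Dual R (LinearMap.ker p)) := Module.Finite.of_surjective _ hsurj
  have hexact : Function.Exact p.dualMap (LinearMap.ker p).subtype.dualMap := by
    intro a
    constructor
    · intro ha
      have hmem : a ∈ (LinearMap.ker p).dualAnnihilator :=
        (Submodule.mem_dualAnnihilator a).2 fun x hx => LinearMap.congr_fun ha ⟨x, hx⟩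
      rwa [← LinearMap.range_dualMap_eq_dualAnnihilator_ker_of_surjective p hp] at hmem
    · rintro ⟨b, rfl⟩
      ext x
      exact (congrArg b x.2).trans (map_zero b)
  intro ψ
  obtain ⟨φ, hφ⟩ := ExtVanish.exists_extend (LinearMap.dualMap_injective_of_surjective hp) hsurj
    hexact (extVanish_one hR) ψ
  obtain ⟨w, rfl⟩ := (Module.bijective_dual_eval R (Fin n → R)).2 φ
  refine ⟨p w, ?_⟩
  rw [← hφ]
  rfl

end Ext

/-! ### Cohen–Macaulay means torsion-free in dimension one -/

section CMIff

lemma exists_isSMulRegular_of_one_le_depth {A : Type u} [CommRing A] [IsLocalRing A] (M : Type u) [AddCommGroup M]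
    [Module A M] (h : 1 ≤ depth A M) : ∃ x ∈ maximalIdeal A, IsSMulRegular M x := by
  by_contra! hc
  have : depth A M ≤ 0 := iSup₂_le fun rs hrs => by
    rcases rs with _ | ⟨x, rs⟩
    · simp
    · exact (hc x (hrs.1 x (by simp))
        ((RingTheory.Sequence.isWeaklyRegular_cons_iff M x rs).1 hrs.2).1).elim
  exact absurd (h.trans this) (by simp)

lemma exists_dvd_pow_of_mem_maximalIdeal {A : Type u} [CommRing A] [IsLocalRing A]
    [Ring.DimensionLEOne A] {c x : A} (hc : c ≠ 0)
    (hx : x ∈ maximalIdeal A) : ∃ k, c ∣ x ^ k := by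
  have : x ∈ (Ideal.span {c}).radical := by
    rw [Ideal.radical_eq_sInf, Ideal.mem_sInf]
    intro q hq
    have : q ≠ ⊥ := fun h => hc (by simpa [h] using hq.1)
    rwa [IsLocalRing.eq_maximalIdeal (hq.2.isMaximal this)]
  obtain ⟨k, hk⟩ := this
  exact ⟨k, Ideal.mem_span_singleton.1 hk⟩

variable {A : Type u} [CommRing A] [IsDomain A] [Ring.DimensionLEOne A]

/-- Heights are at most one, and at a nonzero prime a single nonzero element stays regular after
localisation. -/
lemma isCM_of_isTorsionFree (M : Type u) [AddCommGroup M] [Module A M] [Module.Finite A M]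
    [Module.IsTorsionFree A M] : isCM A (ModuleCat.of A M) := by
  refine ⟨‹_›, fun p _ => ?_⟩
  by_cases hp : p = ⊥
  · subst hp; simp
  have hp1 : p.height ≤ 1 := WithBot.coe_le_coe.1
    (Ideal.height_le_ringKrullDim_of_isPrime.trans (Ring.krullDimLE_iff.1 inferInstance))
  refine hp1.trans ?_
  obtain ⟨x, hx, hx0⟩ := Submodule.exists_mem_ne_zero_of_ne_bot hp
  unfold depth
  refine le_iSup₂_of_le [algebraMap A (Localization.AtPrime p) x] ⟨?_, ?_⟩ (by simp)
  · intro r hr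
    rw [List.mem_singleton.1 hr]
    exact (IsLocalization.AtPrime.to_map_mem_maximal_iff _ p x).2 hx
  · exact RingTheory.Sequence.IsWeaklyRegular.of_isLocalizedModule (rs := [x])
      (Localization.AtPrime p) p.primeCompl (LocalizedModule.mkLinearMap p.primeCompl M)
      (by simpa using IsSMulRegular.of_ne_zero hx0)

/-- At a maximal ideal, positive depth gives a regular `x`, and a nonzero `c` divides a power of `x`
in the local ring; so `c v = 0` forces `v = 0` there. Arguing locally avoids needing `R_n` to be
local. -/
lemma isTorsionFree_of_isCM (hA : ¬ IsField A) {M : ModuleCat.{u} A} (hM : isCM A M) :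
    Module.IsTorsionFree A M := by
  refine ⟨fun c hc => ?_⟩
  rw [isSMulRegular_iff_right_eq_zero_of_smul]
  intro v hv
  refine Module.eq_zero_of_localization_maximal
    (fun (P : Ideal A) _ => LocalizedModule P.primeCompl M)
    (fun (P : Ideal A) _ => LocalizedModule.mkLinearMap P.primeCompl M) v fun p hp => ?_
  have hp0 : p ≠ ⊥ := Ring.ne_bot_of_isMaximal_of_not_isField hp hA
  have hle : p.primeCompl ≤ nonZeroDivisors A := p.primeCompl_le_nonZeroDivisors
  have : IsDomain (Localization.AtPrime p) := IsLocalization.isDomain_localization hle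
  have : Ring.DimensionLEOne (Localization.AtPrime p) :=
    Ring.DimensionLEOne.localization (M := p.primeCompl) _ hle
  have h1 : 1 ≤ p.height := Order.one_le_iff_ne_zero.2 (mt Ideal.height_eq_zero_iff_eq_bot.1 hp0)
  obtain ⟨x, hx, hreg⟩ := exists_isSMulRegular_of_one_le_depth _ (h1.trans (hM.2 p))
  have hc0 : algebraMap A (Localization.AtPrime p) c ≠ 0 := fun h => hc.ne_zero
    (IsLocalization.injective _ hle (h.trans (map_zero _).symm))
  obtain ⟨k, d, hd⟩ := exists_dvd_pow_of_mem_maximalIdeal hc0 hx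
  refine (isSMulRegular_iff_right_eq_zero_of_smul (r := x ^ k)).1 (hreg.pow k) _ ?_
  rw [hd, mul_comm, mul_smul, algebraMap_smul, ← map_smul, hv, map_zero, smul_zero]

end CMIff

/-! ### Torsion-free modules as objects of the stable category -/

section Bookkeeping

variable (R : Type u) [CommRing R] [IsDomain R] [Ring.DimensionLEOne R]

/-- A finitely generated torsion-free module as an object of `CM(R)`. -/
abbrev toCM (M : Type u) [AddCommGroup M] [Module R M] [Module.Finite R M]
    [Module.IsTorsionFree R M] : CMCat R :=
  ⟨ModuleCat.of R M, isCM_of_isTorsionFree M⟩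

/-- A finitely generated torsion-free module as an object of the stable category. -/
abbrev stab (M : Type u) [AddCommGroup M] [Module R M] [Module.Finite R M]
    [Module.IsTorsionFree R M] : StableCM R :=
  (proj R).obj (toCM R M)

variable {R}

variable {M N P : Type u} [AddCommGroup M] [AddCommGroup N] [AddCommGroup P]
  [Module R M] [Module R N] [Module R P] [Module.Finite R M] [Module.Finite R N] [Module.Finite R P]
  [Module.IsTorsionFree R M] [Module.IsTorsionFree R N] [Module.IsTorsionFree R P]

/-- The morphism of the stable category given by a linear map. -/
def stabMap (f : M →ₗ[R] N) : stab R M ⟶ stab R N :=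
  (proj R).map (ObjectProperty.homMk (ModuleCat.ofHom f))

lemma stabMap_comp (f : M →ₗ[R] N) (g : N →ₗ[R] P) :
    stabMap f ≫ stabMap g = stabMap (g ∘ₗ f) := by
  unfold stabMap
  rw [← Functor.map_comp]
  rfl

lemma stabMap_id : stabMap (LinearMap.id : M →ₗ[R] M) = 𝟙 (stab R M) := (proj R).map_id _

lemma stabMap_add (f g : M →ₗ[R] N) :
    stabMap (f + g) = stabMap f + stabMap g := rfl

lemma stabMap_zero : stabMap (0 : M →ₗ[R] N) = 0 := rfl

lemma stabMap_eq_of_factor {Q : Type u} [AddCommGroup Q] [Module R Q] [Module.Finite R Q]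
    [Module.Projective R Q] (f g : M →ₗ[R] N) (a : M →ₗ[R] Q) (b : Q →ₗ[R] N)
    (h : f - g = b ∘ₗ a) : stabMap f = stabMap g := by
  refine CategoryTheory.Quotient.sound _ ⟨ModuleCat.of R Q, ModuleCat.ofHom a, ModuleCat.ofHom b,
    ‹_›, ‹_›, ?_⟩
  ext x
  exact LinearMap.congr_fun h x

/-- Linear equivalences give isomorphisms of the stable category. -/
def stabIso (e : M ≃ₗ[R] N) : stab R M ≅ stab R N where
  hom := stabMap e
  inv := stabMap e.symm
  hom_inv_id := by
    rw [stabMap_comp, ← stabMap_id]; congr 1; ext; simp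
  inv_hom_id := by
    rw [stabMap_comp, ← stabMap_id]; congr 1; ext; simp

/-- Adding a projective summand does not change a module stably. -/
def stabIsoProd [Module.Projective R P] (e : N ≃ₗ[R] (M × P)) :
    stab R N ≅ stab R M where
  hom := stabMap (LinearMap.fst R M P ∘ₗ e)
  inv := stabMap (e.symm.toLinearMap ∘ₗ LinearMap.inl R M P)
  hom_inv_id := by
    rw [stabMap_comp, ← stabMap_id]
    refine stabMap_eq_of_factor _ _ (LinearMap.snd R M P ∘ₗ e)
      (-(e.symm.toLinearMap ∘ₗ LinearMap.inr R M P)) ?_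
    ext x
    apply e.injective
    ext <;> simp
  inv_hom_id := by
    rw [stabMap_comp, ← stabMap_id]; congr 1; ext; simp

lemma isZero_stab [Subsingleton M] : IsZero (stab R M) := by
  rw [IsZero.iff_id_eq_zero, ← stabMap_id, ← stabMap_zero]
  congr 1
  ext x
  exact Subsingleton.elim _ _

/-- The biproduct of the stable category given by a decomposition `P ≃ M × N`. -/
def stabBicone (e : P ≃ₗ[R] (M × N)) : BinaryBicone (stab R M) (stab R N) where
  pt := stab R P
  fst := stabMap (LinearMap.fst R M N ∘ₗ e)
  snd := stabMap (LinearMap.snd R M N ∘ₗ e)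
  inl := stabMap (e.symm.toLinearMap ∘ₗ LinearMap.inl R M N)
  inr := stabMap (e.symm.toLinearMap ∘ₗ LinearMap.inr R M N)
  inl_fst := by rw [stabMap_comp, ← stabMap_id]; congr 1; ext; simp
  inl_snd := by rw [stabMap_comp, ← stabMap_zero]; congr 1; ext; simp
  inr_fst := by rw [stabMap_comp, ← stabMap_zero]; congr 1; ext; simp
  inr_snd := by rw [stabMap_comp, ← stabMap_id]; congr 1; ext; simp

/-- `stabBicone` is a biproduct. -/
def stabBiconeIsBilimit (e : P ≃ₗ[R] (M × N)) : (stabBicone e).IsBilimit :=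
  isBinaryBilimitOfTotal _ (by
    change stabMap (LinearMap.fst R M N ∘ₗ e.toLinearMap) ≫
        stabMap (e.symm.toLinearMap ∘ₗ LinearMap.inl R M N) +
      stabMap (LinearMap.snd R M N ∘ₗ e.toLinearMap) ≫
        stabMap (e.symm.toLinearMap ∘ₗ LinearMap.inr R M N) = 𝟙 (stab R P)
    rw [stabMap_comp, stabMap_comp, ← stabMap_add, ← stabMap_id]
    congr 1
    ext x
    apply e.injective
    ext <;> simp)

/-- An object isomorphic to `X` is a biproduct of `X` and a zero object, so closure under summands
suffices. -/
lemma Gen.of_iso {𝒳 : ObjectProperty (StableCM R)} {X Y : StableCM R} (e : X ≅ Y)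
    (h : Gen 𝒳 Y) : Gen 𝒳 X := by
  let b : BinaryBicone X (stab R PUnit) :=
    { pt := Y, fst := e.inv, snd := 0, inl := e.hom, inr := 0
      inr_snd := isZero_stab.eq_of_src _ _ }
  exact Gen.summand X _ b (isBinaryBilimitOfTotal _ (by simp [b])) h

lemma Gen.prod {𝒳 : ObjectProperty (StableCM R)} (e : P ≃ₗ[R] (M × N)) (hM : Gen 𝒳 (stab R M))
    (hN : Gen 𝒳 (stab R N)) : Gen 𝒳 (stab R P) :=
  Gen.sum _ _ _ (stabBiconeIsBilimit e) hM hN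

lemma Gen.of_prod {𝒳 : ObjectProperty (StableCM R)} (e : P ≃ₗ[R] (M × N))
    (hP : Gen 𝒳 (stab R P)) : Gen 𝒳 (stab R M) :=
  Gen.summand _ _ _ (stabBiconeIsBilimit e) hP

lemma Gen.pi {𝒳 : ObjectProperty (StableCM R)} (h : Gen 𝒳 (stab R M)) (k : ℕ) :
    Gen 𝒳 (stab R (Fin k → M)) := by
  induction k with
  | zero => exact Gen.zero _ isZero_stab
  | succ k ih => exact Gen.prod (Fin.consLinearEquiv R fun _ : Fin (k + 1) => M).symm h ih

/-- A short exact sequence of modules gives a distinguished triangle. -/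
lemma isTriangle_of_exact (f : M →ₗ[R] N) (g : N →ₗ[R] P) (hf : Function.Injective f)
    (hg : Function.Surjective g) (h : Function.Exact f g) :
    IsTriangle (stabMap f) (stabMap g) :=
  ⟨ShortComplex.mk (X₁ := toCM R M) (X₂ := toCM R N) (X₃ := toCM R P)
      (ObjectProperty.homMk (ModuleCat.ofHom f)) (ObjectProperty.homMk (ModuleCat.ofHom g))
      (by ext x; exact h.apply_apply_eq_zero x),
    Iso.refl _, Iso.refl _, Iso.refl _, shortExact_ofHom f g hf hg h,
    (Category.comp_id _).trans (Category.id_comp _).symm,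
    (Category.comp_id _).trans (Category.id_comp _).symm⟩

lemma level_succ_of_exact {G : StableCM R} {k : ℕ} (f : M →ₗ[R] N) (g : N →ₗ[R] P)
    (hf : Function.Injective f) (hg : Function.Surjective g) (h : Function.Exact f g)
    (hM : level G k (stab R M)) (hP : Gen (fun X => X = G) (stab R P)) :
    level G (k + 1) (stab R N) :=
  Gen.of _ ⟨_, _, _, _, hM, hP, isTriangle_of_exact f g hf hg h⟩

lemma level_one_of_gen {G : StableCM R} (h : Gen (fun X => X = G) (stab R M)) :
    level G 1 (stab R M) :=
  level_succ_of_exact (0 : PUnit.{u + 1} →ₗ[R] M) LinearMap.id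
    (Function.injective_of_subsingleton _) Function.surjective_id
    (fun x => by simpa using eq_comm) isZero_stab h

end Bookkeeping

/-! ### The triangle relating a module to a submodule containing `𝔪 M` -/

section Triangle

open Module

variable {R : Type u} [CommRing R] [IsDomain R] [Ring.DimensionLEOne R]

/-- A finitely generated module killed by a maximal ideal `I` is a finite direct sum of copies of
`R / I`. -/
lemma exists_linearEquiv_pi_quotient {R : Type u} [CommRing R] (I : Ideal R) [I.IsMaximal]
    (Q : Type u) [AddCommGroup Q] [Module R Q] [Module.Finite R Q]
    (h : ∀ r ∈ I, ∀ x : Q, r • x = 0) : ∃ s : ℕ, Nonempty (Q ≃ₗ[R] (Fin s → R ⧸ I)) := by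
  have ht : Module.IsTorsionBySet R Q I := fun x r => h r r.2 x
  let := Ideal.Quotient.field I
  let : Module (R ⧸ I) Q := ht.module
  have : IsScalarTower R (R ⧸ I) Q := ht.isScalarTower
  have : Module.Finite (R ⧸ I) Q := Module.Finite.of_restrictScalars_finite R (R ⧸ I) Q
  exact ⟨_, ⟨(Module.finBasis (R ⧸ I) Q).equivFun.restrictScalars R⟩⟩

/-- Some ideal of `R` is an extension of the residue field by `R`. -/
lemma exists_extension_residue [IsLocalRing R] [IsNoetherianRing R] (hR : ¬ IsField R) :
    ∃ (L : Ideal R) (i : R →ₗ[R] L) (q : L →ₗ[R] (R ⧸ maximalIdeal R)),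
      Function.Injective i ∧ Function.Surjective q ∧ Function.Exact i q := by
  obtain ⟨x, y, hx0, -, hxy⟩ := exists_colon_eq_maximalIdeal hR
  -- `L / R x` is generated by the class of `y`, whose annihilator is `(x : y) = 𝔪`.
  let L : Ideal R := Ideal.span {x, y}
  have hxL : x ∈ L := Ideal.subset_span (by simp)
  have hyL : y ∈ L := Ideal.subset_span (by simp)
  let i : R →ₗ[R] L := LinearMap.toSpanSingleton R L ⟨x, hxL⟩
  let g : R →ₗ[R] (L ⧸ LinearMap.range i) :=
    (LinearMap.range i).mkQ ∘ₗ LinearMap.toSpanSingleton R L ⟨y, hyL⟩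
  have hgker : LinearMap.ker g = maximalIdeal R := by
    ext r
    rw [hxy, LinearMap.mem_ker, LinearMap.comp_apply, Submodule.mkQ_apply,
      Submodule.Quotient.mk_eq_zero, LinearMap.mem_range]
    constructor
    · rintro ⟨c, hc⟩
      exact ⟨c, by simpa [i, mul_comm] using (congrArg Subtype.val hc).symm⟩
    · rintro ⟨c, hc⟩
      exact ⟨c, Subtype.ext (by simpa [i, mul_comm] using hc.symm)⟩
  have hg : Function.Surjective g := by
    intro t
    obtain ⟨⟨l, hl⟩, rfl⟩ := Submodule.mkQ_surjective _ t
    obtain ⟨a, b, rfl⟩ := Ideal.mem_span_pair.1 hl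
    refine ⟨b, ?_⟩
    rw [LinearMap.comp_apply, Submodule.mkQ_apply, Submodule.mkQ_apply, Submodule.Quotient.eq]
    exact ⟨-a, Subtype.ext (by simp [i])⟩
  let e := (Submodule.quotEquivOfEq _ _ hgker.symm).trans (g.quotKerEquivOfSurjective hg)
  refine ⟨L, i, e.symm.toLinearMap ∘ₗ (LinearMap.range i).mkQ, fun a b hab => ?_,
    e.symm.surjective.comp (Submodule.mkQ_surjective _), fun l => ?_⟩
  · exact mul_right_cancel₀ hx0 (congrArg Subtype.val hab)
  · simp

variable [IsGorensteinLocalRing R]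

/-- Extensions of finitely generated torsion-free modules by free modules split. -/
lemma exists_linearEquiv_prod_of_exact (hR : ¬ IsField R) {E M : Type u} [AddCommGroup E]
    [AddCommGroup M] [Module R E] [Module R M] [Module.Finite R M] [IsTorsionFree R M] {s : ℕ}
    (f : (Fin s → R) →ₗ[R] E) (g : E →ₗ[R] M) (hf : Function.Injective f)
    (hg : Function.Surjective g) (h : Function.Exact f g) :
    Nonempty (E ≃ₗ[R] (M × (Fin s → R))) := by
  -- Extending each coordinate functional of `R^s` to `E` gives a retraction of `f`.
  choose ρ hρ using fun j => ExtVanish.exists_extend hf hg h (extVanish_one hR)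
    (LinearMap.proj j : (Fin s → R) →ₗ[R] R)
  have hρ' : ∀ r, LinearMap.pi ρ (f r) = r := fun r => by
    ext j
    exact LinearMap.congr_fun (hρ j) r
  refine ⟨LinearEquiv.ofBijective (g.prod (LinearMap.pi ρ)) ⟨?_, ?_⟩⟩
  · refine (injective_iff_map_eq_zero _).2 fun x hx => ?_
    obtain ⟨r, rfl⟩ := (h x).1 (congrArg Prod.fst hx)
    have : r = 0 := (hρ' r).symm.trans (congrArg Prod.snd hx)
    rw [this, map_zero]
  · rintro ⟨m, r⟩
    obtain ⟨x, rfl⟩ := hg m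
    refine ⟨x + f (r - LinearMap.pi ρ x), Prod.ext ?_ ?_⟩
    · simp [h.apply_apply_eq_zero]
    · change LinearMap.pi ρ _ = r
      rw [map_add, hρ', add_sub_cancel]

/-- If `N ⊆ M` contains `𝔪 M`, then `M` is in a triangle with `N` and a sum of copies of the
extension `L` of the residue field. -/
theorem level_succ_of_maximalIdeal_smul_mem (hR : ¬ IsField R) {L : Type u} [AddCommGroup L]
    [Module R L] [Module.Finite R L] [IsTorsionFree R L] (i : R →ₗ[R] L)
    (q : L →ₗ[R] (R ⧸ maximalIdeal R)) (hi : Function.Injective i) (hq : Function.Surjective q)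
    (hiq : Function.Exact i q) {M N : Type u} [AddCommGroup M] [AddCommGroup N] [Module R M]
    [Module R N] [Module.Finite R M] [Module.Finite R N] [IsTorsionFree R M] [IsTorsionFree R N]
    (j : N →ₗ[R] M) (hj : Function.Injective j)
    (hN : ∀ r ∈ maximalIdeal R, ∀ v : M, r • v ∈ LinearMap.range j) {G : StableCM R} {k : ℕ}
    (hG : Gen (fun X => X = G) (stab R L)) (hk : level G k (stab R N)) :
    level G (k + 1) (stab R M) := by
  obtain ⟨s, ⟨e⟩⟩ := exists_linearEquiv_pi_quotient (maximalIdeal R) (M ⧸ LinearMap.range j)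
    (fun r hr x => by
      obtain ⟨v, rfl⟩ := Submodule.mkQ_surjective _ x
      rw [← map_smul, Submodule.mkQ_apply, Submodule.Quotient.mk_eq_zero]
      exact hN r hr v)
  let p : M →ₗ[R] (Fin s → R ⧸ maximalIdeal R) := e.toLinearMap ∘ₗ (LinearMap.range j).mkQ
  have hp : Function.Surjective p := e.surjective.comp (Submodule.mkQ_surjective _)
  have hpj : Function.Exact j p := fun v => by simp [p]
  let π : (Fin s → L) →ₗ[R] (Fin s → R ⧸ maximalIdeal R) := q.compLeft (Fin s)
  have hπ : Function.Surjective π := hq.comp_left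
  -- The pullback of `p` and `π`: its projection to `M` has kernel `ker π = R^s`, its projection to
  -- `L^s` has kernel `ker p = N`.
  let E : Submodule R (M × (Fin s → L)) := LinearMap.eqLocus (p ∘ₗ LinearMap.fst R _ _)
    (π ∘ₗ LinearMap.snd R _ _)
  have hE : ∀ x, x ∈ E ↔ p x.1 = π x.2 := fun x => Iff.rfl
  let f₁ : (Fin s → R) →ₗ[R] E := LinearMap.codRestrict E
    (LinearMap.inr R M _ ∘ₗ i.compLeft (Fin s)) fun r => by
      rw [hE]
      ext t
      simp [π, hiq.apply_apply_eq_zero]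
  let g₁ : E →ₗ[R] M := LinearMap.fst R _ _ ∘ₗ E.subtype
  have hf₁ : Function.Injective f₁ := fun a b hab =>
    hi.comp_left (congrArg (fun x : E => x.1.2) hab)
  have hg₁ : Function.Surjective g₁ := fun m => by
    obtain ⟨l, hl⟩ := hπ (p m)
    exact ⟨⟨(m, l), hl.symm⟩, rfl⟩
  have h₁ : Function.Exact f₁ g₁ := by
    rintro ⟨⟨m, l⟩, hml⟩
    constructor
    · intro (hm : m = 0)
      subst hm
      have hl : ∀ t, ∃ r, i r = l t := fun t => (hiq _).1 (by
        simpa [π] using (congrFun ((hE _).1 hml) t).symm)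
      choose r hr using hl
      exact ⟨r, Subtype.ext (Prod.ext rfl (funext hr))⟩
    · rintro ⟨r, hr⟩
      exact (congrArg (fun x : E => x.1.1) hr).symm
  let f₂ : N →ₗ[R] E := LinearMap.codRestrict E (LinearMap.inl R M _ ∘ₗ j) fun r => by
    simp [hE, hpj.apply_apply_eq_zero]
  let g₂ : E →ₗ[R] (Fin s → L) := LinearMap.snd R _ _ ∘ₗ E.subtype
  have hf₂ : Function.Injective f₂ := fun a b hab => hj (congrArg (fun x : E => x.1.1) hab)
  have hg₂ : Function.Surjective g₂ := fun l => by
    obtain ⟨m, hm⟩ := hp (π l)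
    exact ⟨⟨(m, l), hm⟩, rfl⟩
  have h₂ : Function.Exact f₂ g₂ := by
    rintro ⟨⟨m, l⟩, hml⟩
    constructor
    · intro (hl : l = 0)
      subst hl
      obtain ⟨n, hn⟩ := (hpj m).1 (((hE _).1 hml).trans (map_zero π))
      exact ⟨n, Subtype.ext (Prod.ext hn rfl)⟩
    · rintro ⟨r, hr⟩
      exact (congrArg (fun x : E => x.1.2) hr).symm
  obtain ⟨eE⟩ := exists_linearEquiv_prod_of_exact hR f₁ g₁ hf₁ hg₁ h₁
  exact Gen.of_iso (stabIsoProd eE).symm (level_succ_of_exact f₂ g₂ hf₂ hg₂ h₂ hk (hG.pi s))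

end Triangle

/-! ### Modules inside a `K`-vector space and the rings `R_n` -/

section Rings

open Module

variable {R : Type u} [CommRing R]

/-- Along an integral extension every maximal ideal contracts to `𝔪`. -/
lemma algebraMap_mem_jacobson [IsLocalRing R] (S : Type u) [CommRing S] [Algebra R S]
    [Algebra.IsIntegral R S] {r : R} (hr : r ∈ maximalIdeal R) :
    algebraMap R S r ∈ Ring.jacobson S := by
  rw [Ring.jacobson_eq_sInf_isMaximal, Ideal.mem_sInf]
  intro I hI
  have : I.IsMaximal := hI
  have := Ideal.isMaximal_comap_of_isIntegral_of_isMaximal (R := R) I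
  rw [← IsLocalRing.eq_maximalIdeal this] at hr
  exact hr

variable {V : Type u} [AddCommGroup V] [Module R V] [Module (FractionRing R) V]

/-- An `R`-submodule of a vector space over the field of fractions is stable under an
intermediate ring `S`. -/
def IsStable (S : Subalgebra R (FractionRing R)) (M : Submodule R V) : Prop :=
  ∀ s ∈ S, ∀ v ∈ M, s • v ∈ M

/-- The product of the Jacobson radical of `S` and a submodule. -/
def jacMul (S : Subalgebra R (FractionRing R)) (M : Submodule R V) : Submodule R V :=
  Submodule.span R {w | ∃ j ∈ Ring.jacobson S, ∃ v ∈ M, w = (j : FractionRing R) • v}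

lemma jacMul_le {S : Subalgebra R (FractionRing R)} {M : Submodule R V} (h : IsStable S M) :
    jacMul S M ≤ M := by
  refine Submodule.span_le.2 ?_
  rintro _ ⟨j, -, v, hv, rfl⟩
  exact h j j.2 v hv

variable [IsScalarTower R (FractionRing R) V]

/-- `J : J` maps `J` into itself, hence also `J M`. This is the passage from `R_l` to `R_{l+1}`. -/
lemma isStable_jacMul (S : Subalgebra R (FractionRing R)) (M : Submodule R V) :
    IsStable (endMax S) (jacMul S M) := by
  intro s hs v hv
  induction hv using Submodule.span_induction with
  | mem v hv =>
    obtain ⟨j, hj, v, hv, rfl⟩ := hv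
    obtain ⟨z, hz, hz'⟩ := hs j hj
    exact Submodule.subset_span ⟨z, hz, v, hv, by rw [hz', mul_smul]⟩
  | zero => rw [smul_zero]; exact zero_mem _
  | add x y _ _ hx hy => rw [smul_add]; exact add_mem hx hy
  | smul r x _ hx =>
    rw [smul_comm]
    exact Submodule.smul_mem _ r hx

lemma smul_mem_jacMul [IsLocalRing R] (S : Subalgebra R (FractionRing R)) [Module.Finite R S]
    (M : Submodule R V) {r : R} (hr : r ∈ maximalIdeal R) {v : V} (hv : v ∈ M) :
    r • v ∈ jacMul S M :=
  Submodule.subset_span ⟨_, algebraMap_mem_jacobson S hr, v, hv, (algebraMap_smul _ r v).symm⟩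

variable [IsDomain R]

/-- Multiplication by a nonzero `x ∈ 𝔪` embeds `J : J` into the Noetherian `R`-module `S`. -/
lemma finite_endMax [IsLocalRing R] [IsNoetherianRing R] (hR : ¬ IsField R)
    (S : Subalgebra R (FractionRing R)) [Module.Finite R S] : Module.Finite R (endMax S) := by
  obtain ⟨x, hx, hx0⟩ := Submodule.exists_mem_ne_zero_of_ne_bot
    (mt IsLocalRing.isField_iff_maximalIdeal_eq.2 hR)
  have hxJ := algebraMap_mem_jacobson S hx
  have hxK : algebraMap R (FractionRing R) x ≠ 0 := fun h =>
    hx0 (IsFractionRing.injective R (FractionRing R) (h.trans (map_zero _).symm))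
  have hmem : ∀ t : endMax S, ∃ z : S,
      (z : FractionRing R) = t * algebraMap R (FractionRing R) x := fun t => by
    obtain ⟨z, -, hz⟩ := t.2 _ hxJ
    exact ⟨z, hz⟩
  choose z hz using hmem
  let f : endMax S →ₗ[R] S :=
    { toFun := z
      map_add' := fun a b => Subtype.ext (by simp [hz, add_mul])
      map_smul' := fun r a => Subtype.ext (by simp [hz]) }
  refine Module.Finite.of_injective f fun a b hab => Subtype.ext (mul_right_cancel₀ hxK ?_)
  rw [← hz, ← hz]
  exact congrArg Subtype.val hab

lemma finite_iterEnd [IsLocalRing R] [IsNoetherianRing R] (hR : ¬ IsField R) (n : ℕ) :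
    Module.Finite R (iterEnd R n) := by
  induction n with
  | zero => exact inferInstanceAs (Module.Finite R (⊥ : Subalgebra R (FractionRing R)))
  | succ n ih => exact finite_endMax hR _

/-- A finitely generated submodule without a surjection onto `R` is stable under `𝔪 : 𝔪`. -/
lemma isStable_iterEnd_one [IsGorensteinLocalRing R] [Ring.DimensionLEOne R] (hR : ¬ IsField R)
    [IsTorsionFree R V] (M : Submodule R V) [Module.Finite R M]
    (hM : ∀ f : M →ₗ[R] R, ¬ Function.Surjective f) : IsStable (iterEnd R 1) M := by
  intro r hr v hv
  have hinj := IsFractionRing.injective R (FractionRing R)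
  have := finite_iterEnd hR 0
  have hfm : ∀ f : M →ₗ[R] R, f ⟨v, hv⟩ ∈ maximalIdeal R := fun f =>
    IsLocalRing.le_maximalIdeal (mt LinearMap.range_eq_top.1 (hM f)) (LinearMap.mem_range_self f _)
  have hmem : ∀ f : M →ₗ[R] R, ∃ c : R,
      algebraMap R (FractionRing R) c = r * algebraMap R (FractionRing R) (f ⟨v, hv⟩) := by
    intro f
    obtain ⟨z, -, hz⟩ := hr _ (algebraMap_mem_jacobson (iterEnd R 0) (hfm f))
    obtain ⟨c, hc⟩ := Algebra.mem_bot.1 z.2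
    exact ⟨c, hc.trans hz⟩
  choose c hc using hmem
  -- The functional `f ↦ r f(v)` takes values in `R` because `f(v) ∈ 𝔪`. Reflexivity represents it
  -- by `w`, and clearing the denominator of `r = a / b` shows `w = r v`.
  let ψ : Dual R (Dual R M) :=
    { toFun := c
      map_add' := fun f g => hinj (by simp [hc, mul_add])
      map_smul' := fun a f => hinj (by simp [hc, mul_left_comm]) }
  obtain ⟨w, hw⟩ := dual_eval_surjective hR ψ
  obtain ⟨a, b, hb, rfl⟩ := IsFractionRing.div_surjective (A := R) r
  have hb0 : b ≠ 0 := nonZeroDivisors.ne_zero hb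
  have hbK : algebraMap R (FractionRing R) b ≠ 0 := fun h => hb0 (hinj (h.trans (map_zero _).symm))
  have hab : b • w = a • (⟨v, hv⟩ : M) := by
    apply dual_eval_injective (R := R)
    ext f
    have hfw : f w = c f := LinearMap.congr_fun hw f
    apply hinj
    change algebraMap R (FractionRing R) (f (b • w)) =
      algebraMap R (FractionRing R) (f (a • ⟨v, hv⟩))
    rw [f.map_smul, f.map_smul, hfw, smul_eq_mul, smul_eq_mul, map_mul, map_mul, hc, ← mul_assoc,
      mul_div_cancel₀ _ hbK]
  have : (algebraMap R (FractionRing R) a / algebraMap R (FractionRing R) b) • v = w := by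
    apply smul_right_injective V hb0
    change b • _ = b • (w : V)
    rw [← Submodule.coe_smul, hab, ← algebraMap_smul (FractionRing R) b, smul_smul,
      mul_div_cancel₀ _ hbK, algebraMap_smul]
    rfl
  rw [this]
  exact w.2

end Rings

/-! ### Counting levels and the theorem -/

section Main

open Module

variable {R : Type u} [CommRing R] [IsDomain R] [Ring.DimensionLEOne R]

/-- A summand over `S` of a power of `G` is generated by `G` over `R`. -/
lemma gen_of_linearEquiv [IsNoetherianRing R] {S : Type u} [CommRing S] [Algebra R S]
    {G M N : Type u} [AddCommGroup G] [AddCommGroup M] [AddCommGroup N] [Module R G] [Module R M]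
    [Module S G] [Module S M] [Module S N] [IsScalarTower R S G] [IsScalarTower R S M]
    [Module.Finite R G] [Module.Finite R M] [IsTorsionFree R G] [IsTorsionFree R M] {k : ℕ}
    (e : (M × N) ≃ₗ[S] (Fin k → G)) {𝒳 : ObjectProperty (StableCM R)} (h : Gen 𝒳 (stab R G)) :
    Gen 𝒳 (stab R M) := by
  -- The complement has only an `S`-structure; restricted to `R` it is finite and torsion-free as a
  -- submodule of `G^k`.
  let : Module R N := Module.compHom N (algebraMap R S)
  have : IsScalarTower R S N := IsScalarTower.of_algebraMap_smul fun _ _ => rfl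
  let e' := e.restrictScalars R
  have hinj : Function.Injective (e'.toLinearMap ∘ₗ LinearMap.inr R M N) :=
    e'.injective.comp LinearMap.inr_injective
  have : Module.Finite R N := Module.Finite.of_injective _ hinj
  have : IsTorsionFree R N := hinj.moduleIsTorsionFree _ (map_smul _)
  exact Gen.of_prod e'.symm (h.pi k)

variable [IsGorensteinLocalRing R]

variable {V : Type u} [AddCommGroup V] [Module R V] [Module (FractionRing R) V]
  [IsScalarTower R (FractionRing R) V] [IsTorsionFree R V]

/-- A stable submodule is a finitely generated torsion-free `S`-module, hence Cohen–Macaulay over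
`S`, hence in `add G`. -/
lemma level_one_of_isStable (S : Subalgebra R (FractionRing R)) [Module.Finite R S]
    {G : ModuleCat.{u} S} (hG : ∀ M : ModuleCat.{u} S, isCM S M ↔ InAdd G M)
    [Module R G] [IsScalarTower R S G] [Module.Finite R G] [IsTorsionFree R G]
    {H : StableCM R} (hH : Gen (fun X => X = H) (stab R G))
    (M : Submodule R V) [Module.Finite R M] (hM : IsStable S M) : level H 1 (stab R M) := by
  let M' : Submodule S V :=
    { M with smul_mem' := fun s v hv => hM s s.2 v hv }
  have : IsTorsionFree S V := IsTorsionFree.trans (FractionRing R)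
  have : Ring.DimensionLEOne S := Ring.DimensionLEOne.of_isIntegral R S
  have hfin : Module.Finite R M' := ‹Module.Finite R M›
  have : Module.Finite S M' := Module.Finite.of_restrictScalars_finite R S M'
  obtain ⟨k, N, ⟨e⟩⟩ := (hG _).1 (isCM_of_isTorsionFree M')
  have : IsTorsionFree R M' := inferInstanceAs (IsTorsionFree R M)
  exact level_one_of_gen (M := M) (gen_of_linearEquiv (M := M') e hH)

/-- Submodules stable under the ring `R_{n-k}` are built in `k + 1` steps. -/
theorem level_of_isStable (hR : ¬ IsField R) {n : ℕ} {G : ModuleCat.{u} (iterEnd R n)}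
    (hG : ∀ M : ModuleCat.{u} (iterEnd R n), isCM (iterEnd R n) M ↔ InAdd G M)
    [Module R G] [IsScalarTower R (iterEnd R n) G] [Module.Finite R G] [IsTorsionFree R G]
    {L : Type u} [AddCommGroup L] [Module R L] [Module.Finite R L] [IsTorsionFree R L]
    (i : R →ₗ[R] L) (q : L →ₗ[R] (R ⧸ maximalIdeal R)) (hi : Function.Injective i)
    (hq : Function.Surjective q) (hiq : Function.Exact i q)
    {H : StableCM R} (hH : Gen (fun X => X = H) (stab R G)) (hL : Gen (fun X => X = H) (stab R L))
    (k l : ℕ) (hkl : l + k = n) (M : Submodule R V) [Module.Finite R M]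
    (hM : IsStable (iterEnd R l) M) : level H (k + 1) (stab R M) := by
  have := finite_iterEnd hR (R := R)
  induction k generalizing l M with
  | zero =>
    obtain rfl : l = n := hkl
    exact level_one_of_isStable _ hG hH M hM
  | succ k ih =>
    have hle := jacMul_le hM
    have hfin : Module.Finite R (jacMul (iterEnd R l) M) :=
      Module.Finite.of_injective _ (Submodule.inclusion_injective hle)
    refine level_succ_of_maximalIdeal_smul_mem hR i q hi hq hiq (Submodule.inclusion hle)
      (Submodule.inclusion_injective hle) (fun r hr v => ?_) hL
      (ih (l + 1) (by omega) _ (isStable_jacMul (iterEnd R l) M))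
    exact ⟨⟨r • (v : V), smul_mem_jacMul (iterEnd R l) M hr v.2⟩, rfl⟩

/-- Free summands do not matter for membership in a level. -/
theorem level_of_no_surjection {H : StableCM R} {k : ℕ}
    (h : ∀ (M : Type u) [AddCommGroup M] [Module R M] [Module.Finite R M] [IsTorsionFree R M],
      (∀ f : M →ₗ[R] R, ¬ Function.Surjective f) → level H (k + 1) (stab R M))
    (M : Type u) [AddCommGroup M] [Module R M] [Module.Finite R M] [IsTorsionFree R M] :
    level H (k + 1) (stab R M) := by
  -- A surjection onto `R` splits off a stably trivial summand and lowers the rank.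
  induction hd : finrank R M using Nat.strong_induction_on generalizing M with
  | _ d ih =>
    by_cases hM : ∀ f : M →ₗ[R] R, ¬ Function.Surjective f
    · exact h M hM
    push Not at hM
    obtain ⟨f, hf⟩ := hM
    obtain ⟨t, ht⟩ := hf 1
    have hrank : finrank R (LinearMap.ker f) < d := by
      have h₁ := Submodule.finrank_quotient_add_finrank (LinearMap.ker f)
      have h₂ := (f.quotKerEquivOfSurjective hf).finrank_eq
      rw [finrank_self] at h₂
      omega
    let g : M →ₗ[R] LinearMap.ker f := LinearMap.codRestrict _
      (LinearMap.id - (LinearMap.toSpanSingleton R M t) ∘ₗ f) fun x => by simp [ht]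
    let e : M ≃ₗ[R] (LinearMap.ker f × R) := LinearEquiv.ofBijective (g.prod f) ⟨by
      refine (injective_iff_map_eq_zero _).2 fun x hx => ?_
      have h₁ : f x = 0 := congrArg Prod.snd hx
      have h₂ : x - f x • t = 0 := congrArg (fun y => (y.1 : M)) hx
      rwa [h₁, zero_smul, sub_zero] at h₂, by
      rintro ⟨⟨x, hx⟩, r⟩
      rw [LinearMap.mem_ker] at hx
      exact ⟨x + r • t, Prod.ext (Subtype.ext (by simp [g, hx, ht])) (by simp [hx, ht])⟩⟩
    exact Gen.of_iso (stabIsoProd e) (ih _ hrank (LinearMap.ker f) rfl)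

end Main

end CMStable

end

theorem proposition3p1 {R : Type u} [CommRing R] [IsDomain R] [CMStable.IsGorensteinLocalRing R]
    [IsAdicComplete (IsLocalRing.maximalIdeal R) R]
    (hdim : ringKrullDim R = 1) (hsing : ¬ IsRegularLocalRing R)
    (n : ℕ) (hn : 1 ≤ n) (hfin : CMStable.CMFiniteType (CMStable.iterEnd R n)) :
    CMStable.stableDim R ≤ ((n - 1 : ℕ) : ℕ∞) := by
  have hR : ¬ IsField R := fun h => by
    rw [ringKrullDim_eq_zero_of_isField h] at hdim
    exact zero_ne_one hdim
  have hdim' : Ring.KrullDimLE 1 R := Ring.krullDimLE_iff.2 hdim.le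
  have : Ring.DimensionLEOne R :=
    ⟨fun {p} hp0 hp => Ring.krullDimLE_one_iff_of_isPrime_bot.1 hdim' p hp0 hp⟩
  have hfinS := CMStable.finite_iterEnd hR n
  have : Ring.DimensionLEOne (CMStable.iterEnd R n) := Ring.DimensionLEOne.of_isIntegral R _
  have hS : ¬ IsField (CMStable.iterEnd R n) := fun h => hR <|
    (Algebra.IsIntegral.isField_iff_isField (FaithfulSMul.algebraMap_injective R _)).2 h
  obtain ⟨G, hGfin, hG⟩ := hfin
  have hGCM : CMStable.isCM _ G := (hG G).2 ⟨1, ModuleCat.of _ PUnit,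
    ⟨LinearEquiv.prodUnique.trans (LinearEquiv.funUnique (Fin 1) _ G).symm⟩⟩
  have := CMStable.isTorsionFree_of_isCM hS hGCM
  let : Module R G := Module.compHom G (algebraMap R (CMStable.iterEnd R n))
  have : IsScalarTower R (CMStable.iterEnd R n) G :=
    IsScalarTower.of_algebraMap_smul fun _ _ => rfl
  have : Module.Finite R G := Module.Finite.trans (CMStable.iterEnd R n) G
  have : Module.IsTorsionFree R G := Module.IsTorsionFree.trans (CMStable.iterEnd R n)
  obtain ⟨L, i, q, hi, hq, hiq⟩ := CMStable.exists_extension_residue hR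
  let H := CMStable.stab R (G × L)
  have hH : CMStable.Gen (fun X => X = H) H := .of _ rfl
  have hHG : CMStable.Gen (fun X => X = H) (CMStable.stab R G) :=
    CMStable.Gen.of_prod (LinearEquiv.refl R (G × L)) hH
  have hHL : CMStable.Gen (fun X => X = H) (CMStable.stab R L) :=
    CMStable.Gen.of_prod (LinearEquiv.prodComm R G L) hH
  refine iInf₂_le (n - 1) ⟨H, fun X => ?_⟩
  have := X.as.property.1
  have := CMStable.isTorsionFree_of_isCM hR X.as.property
  refine CMStable.level_of_no_surjection (H := H) (k := n - 1) (fun M _ _ _ _ hM => ?_) X.as.obj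
  -- Embedding `M` in `K^d` provides the ambient space in which the rings `R_l` act.
  obtain ⟨d, f, hf⟩ := CMStable.exists_injective_fin_pi (R := R) (M := M)
  let g : M →ₗ[R] (Fin d → FractionRing R) :=
    (Algebra.linearMap R (FractionRing R)).compLeft (Fin d) ∘ₗ f
  have hg : Function.Injective g :=
    (IsFractionRing.injective R (FractionRing R)).comp_left.comp hf
  let e := LinearEquiv.ofInjective g hg
  have hst : CMStable.IsStable (CMStable.iterEnd R 1) (LinearMap.range g) :=
    CMStable.isStable_iterEnd_one hR _ fun a ha => hM (a ∘ₗ e.toLinearMap) (ha.comp e.surjective)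
  -- Starting at `R_1` instead of `R_0` saves one step: `n - 1` steps reach `R_n`, giving level `(n
  -- - 1) + 1`. Here `1 + (n - 1) = n` needs `n ≥ 1`.
  exact CMStable.Gen.of_iso (CMStable.stabIso e)
    (CMStable.level_of_isStable hR hG i q hi hq hiq hHG hHL (n - 1) 1 (by omega) _ hst)
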